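/- Let $(M,d)$ be a compact metric space and $\mu$ a Borel probability measure on $M$ whose support is all of $M$. Let $\Omega=M^{\mathbb N}$ be the space of sequences $x=(x_1,x_2,\dots)$ with the metric $d_\Omega(x,y)=\sum_{n\ge1}2^{-n}d(x_n,y_n)$, let $\sigma(x_1,x_2,\dots)=(x_2,x_3,\dots)$ be the left shift, and let $C(\Omega)$ be the space of continuous functions $\Omega\to\mathbb R$ with the supremum norm $\|\cdot\|_0$. For $f\in C(\Omega)$ write $S_nf=\sum_{i=0}^{n-1}f\circ\sigma^i$ and $$C_f(x,y)=\sup_{n\ge1}\ \sup_{\mathbf a\in M^n}\bigl(S_nf(\mathbf a x)-S_nf(\mathbf a y)\bigr)\in(-\infty,+\infty],$$ where $\mathbf a x=(a_1,\dots,a_n,x_1,x_2,\dots)$. The function $f$ satisfies the weak Walters condition if $C_f(x,y)\to0$ as $d_\Omega(x,y)\to0$. The Ruelle operator $\mathscr L_f:C(\Omega)\to C(\Omega)$ is $$\mathscr L_f\varphi(x)=\int_M e^{f(ax)}\varphi(ax)\,d\mu(a),$$ and $\mathscr L_f^*$ is its dual operator on $C(\Omega)^*$, in which Borel probability measures are regarded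 as the functionals $\varphi\mapsto\int_\Omega\varphi\,d\nu$. Suppose that $f\in C(\Omega)$ satisfies the weak Walters condition. Then there are a real number $\lambda_f>0$, a strictly positive function $h_f\in C(\Omega)$ and a Borel probability measure $\nu_f$ on $\Omega$ such that i) $\mathscr L_fh_f=\lambda_fh_f$ and $\mathscr L_f^*\nu_f=\lambda_f\nu_f$, and $\nu_f$ is the unique Borel probability measure $\nu$ on $\Omega$ with $\mathscr L_f^*\nu=\lambda_f\nu$; ii) for every $\varphi\in C(\Omega)$, $\ \bigl\|\lambda_f^{-n}\mathscr L_f^n\varphi-h_f\int_\Omega\varphi\,d\nu_f\bigr\|_0\to0$ as $n\to\infty$. -/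

import Mathlib

open MeasureTheory Filter Topology

namespace RuelleOp

variable {M : Type*}

/-- The left shift on one-sided sequences (coordinates are indexed from `0`). -/
def shift (x : ℕ → M) : ℕ → M := fun k => x (k + 1)

/-- The sequence `(a, x 0, x 1, …)`. -/
def cons (a : M) (x : ℕ → M) : ℕ → M
  | 0 => a
  | k + 1 => x k

/-- The sequence `(a 0, …, a (n-1), x 0, x 1, …)`. -/
def concat {n : ℕ} (a : Fin n → M) (x : ℕ → M) : ℕ → M :=
  fun k => if h : k < n then a ⟨k, h⟩ else x (k - n)

/-- The metric `∑ 2^{-n} d(x_n, y_n)` on the sequence space, with the first coordinate carrying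
the weight `1/2`. -/
noncomputable def seqDist [MetricSpace M] (x y : ℕ → M) : ℝ :=
  ∑' k : ℕ, (1 / 2 : ℝ) ^ (k + 1) * dist (x k) (y k)

/-- `C_f(x,y)`: the supremum, over `n ≥ 1` and words `a` of length `n`, of
`S_n f (a x) - S_n f (a y)`, taken in the extended reals. -/
noncomputable def walters [TopologicalSpace M] (f : C(ℕ → M, ℝ)) (x y : ℕ → M) : EReal :=
  ⨆ (n : ℕ) (_ : 1 ≤ n) (a : Fin n → M),
    ((birkhoffSum shift f n (concat a x) - birkhoffSum shift f n (concat a y) : ℝ) : EReal)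

/-- The weak Walters condition: `C_f(x,y) → 0` as the distance of `x` and `y` tends to `0`. -/
def WeakWalters [MetricSpace M] (f : C(ℕ → M, ℝ)) : Prop :=
  Tendsto (fun p : (ℕ → M) × (ℕ → M) => walters f p.1 p.2)
    (comap (fun p : (ℕ → M) × (ℕ → M) => seqDist p.1 p.2) (𝓝 0)) (𝓝 0)

theorem continuous_cons [TopologicalSpace M] :
    Continuous fun p : (ℕ → M) × M => cons p.2 p.1 := by
  refine continuous_pi fun k => ?_
  cases k with
  | zero => exact continuous_snd
  | succ k => exact (continuous_apply k).comp continuous_fst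

theorem continuous_integrand [TopologicalSpace M] (f φ : C(ℕ → M, ℝ)) :
    Continuous fun p : (ℕ → M) × M => Real.exp (f (cons p.2 p.1)) * φ (cons p.2 p.1) :=
  (Real.continuous_exp.comp (f.continuous.comp continuous_cons)).mul
    (φ.continuous.comp continuous_cons)

variable [MetricSpace M] [CompactSpace M] [MeasurableSpace M] [BorelSpace M]

theorem integrable_integrand (μ : Measure M) [IsProbabilityMeasure μ] (f φ : C(ℕ → M, ℝ))
    (x : ℕ → M) : Integrable (fun a => Real.exp (f (cons a x)) * φ (cons a x)) μ :=
  ((continuous_integrand f φ).comp (Continuous.prodMk_right x)).integrable_of_hasCompactSupport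
    (HasCompactSupport.of_compactSpace _)

/-- The Ruelle operator `(L_f φ)(x) = ∫ e^{f(ax)} φ(ax) dμ(a)`, as a bounded linear operator on
the space of continuous functions with the supremum norm. -/
noncomputable def ruelle (μ : Measure M) [IsProbabilityMeasure μ] (f : C(ℕ → M, ℝ)) :
    C(ℕ → M, ℝ) →L[ℝ] C(ℕ → M, ℝ) :=
  LinearMap.mkContinuous
    { toFun := fun φ =>
        ⟨fun x => ∫ a, Real.exp (f (cons a x)) * φ (cons a x) ∂μ, by
          have h := continuous_parametric_integral_of_continuous (μ := μ)
            (f := fun (x : ℕ → M) (a : M) => Real.exp (f (cons a x)) * φ (cons a x))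
            (continuous_integrand f φ) (s := Set.univ) isCompact_univ
          simpa using h⟩
      map_add' := fun φ ψ => by
        ext x
        simp only [ContinuousMap.coe_mk, ContinuousMap.add_apply, mul_add]
        exact integral_add (integrable_integrand μ f φ x) (integrable_integrand μ f ψ x)
      map_smul' := fun c φ => by
        ext x
        simp only [ContinuousMap.coe_mk, ContinuousMap.smul_apply, smul_eq_mul, RingHom.id_apply,
          mul_left_comm _ c]
        exact integral_const_mul c _ }
    (Real.exp ‖f‖) fun φ => by
      refine (ContinuousMap.norm_le _ (by positivity)).2 fun x => ?_
      have h := norm_integral_le_of_norm_le_const (μ := μ)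
        (f := fun a => Real.exp (f (cons a x)) * φ (cons a x))
        (C := Real.exp ‖f‖ * ‖φ‖) (Eventually.of_forall fun a => by
          rw [norm_mul, Real.norm_eq_abs (Real.exp _), Real.abs_exp]
          gcongr
          · exact (le_abs_self _).trans (f.norm_coe_le_norm _)
          · exact φ.norm_coe_le_norm _)
      simpa using h

/-- The bounded linear functional `φ ↦ ∫ φ dν` given by a Borel probability measure. -/
noncomputable def toDual (ν : ProbabilityMeasure (ℕ → M)) : StrongDual ℝ C(ℕ → M, ℝ) :=
  LinearMap.mkContinuous
    { toFun := fun φ => ∫ x, φ x ∂(ν : Measure (ℕ → M))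
      map_add' := fun φ ψ => integral_add
        (φ.continuous.integrable_of_hasCompactSupport (HasCompactSupport.of_compactSpace _))
        (ψ.continuous.integrable_of_hasCompactSupport (HasCompactSupport.of_compactSpace _))
      map_smul' := fun c φ => integral_const_mul c _ }
    1 fun φ => by
      have h := norm_integral_le_of_norm_le_const (μ := (ν : Measure (ℕ → M)))
        (f := fun x => φ x) (Eventually.of_forall fun x => φ.norm_coe_le_norm x)
      simpa using h

/-- The dual operator `L_f^*`, acting on bounded linear functionals by `(L_f^* ℓ)(φ) = ℓ(L_f φ)`. -/
noncomputable def ruelleDual (μ : Measure M) [IsProbabilityMeasure μ] (f : C(ℕ → M, ℝ))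
    (l : StrongDual ℝ C(ℕ → M, ℝ)) : StrongDual ℝ C(ℕ → M, ℝ) :=
  l.comp (ruelle μ f)

end RuelleOp

open RuelleOp

/-! The integrals of `ruelle μ f ^ n` at two points are compared word by word
(`ruelle_pow_le_mul_of_forall_word`), so bounds on differences of Birkhoff sums become bounds on
ratios of iterates, uniform in `n`. Hence the iterates of `1` oscillate by a bounded factor, the
logarithm of their value at a point is almost additive, and they stay within constant factors of
`lam ^ n`. Thus `T = lam⁻¹ • ruelle μ f` is power bounded, and the orbit under `T` of a positive
function is equicontinuous. Cesàro averages of `T ^ n 1` accumulate at a positive fixed point `h`.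

For `ψ > 0`, the maximum of `T ^ n ψ / h` decreases to some `S`. If `w` is a limit point of the
orbit, every `T ^ m w / h` has maximum `S`; where it is attained, full support of `μ` makes `S • h -
w` vanish at all `m`-fold preimages. As `m` grows these become dense, so `w = S • h`, and power
boundedness yields convergence of the whole orbit. The limiting coefficient is a positive functional
of the starting function, represented by `ν`. -/

namespace RuelleOp

/-! ### Words prefixed to sequences -/

section Words

variable {M : Type*}

/-- The outermost integration in `ruelle μ f ^ (n + 1)` is over the letter next to the tail, so
inductions on word length peel off the last letter. -/
theorem concat_snoc {n : ℕ} (a : Fin n → M) (b : M) (x : ℕ → M) :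
    concat (Fin.snoc (α := fun _ => M) a b) x = concat a (cons b x) := by
  funext k
  rcases lt_trichotomy k n with h | h | h
  · have h' : k < n + 1 := by omega
    simp [concat, h, h', Fin.snoc]
  · subst h
    simp [concat, Fin.snoc, cons]
  · have h1 : ¬ k < n + 1 := by omega
    have h2 : ¬ k < n := by omega
    obtain ⟨j, rfl⟩ : ∃ j, k = n + 1 + j := ⟨k - (n + 1), by omega⟩
    have h3 : n + 1 + j - n = j + 1 := by omega
    simp [concat, h1, h2, h3, cons]

theorem concat_zero (a : Fin 0 → M) (x : ℕ → M) : concat a x = x := by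
  funext k
  simp [concat]

theorem shift_iterate_apply (n : ℕ) (x : ℕ → M) (k : ℕ) : shift^[n] x k = x (k + n) := by
  induction n generalizing x with
  | zero => rfl
  | succ n ih =>
    rw [Function.iterate_succ_apply, ih]
    simp only [shift]
    congr 1

theorem shift_iterate_concat {n : ℕ} (a : Fin n → M) (x : ℕ → M) :
    shift^[n] (concat a x) = x := by
  funext k
  simp [shift_iterate_apply, concat]

theorem birkhoffSum_concat_snoc (f : (ℕ → M) → ℝ) {n : ℕ} (a : Fin n → M) (b : M) (x : ℕ → M) :
    birkhoffSum shift f (n + 1) (concat (Fin.snoc (α := fun _ => M) a b) x) =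
      birkhoffSum shift f n (concat a (cons b x)) + f (cons b x) := by
  rw [birkhoffSum_succ, concat_snoc, shift_iterate_concat]

end Words

/-! ### The sequence metric and the Walters bounds -/

section Distance

variable {M : Type*} [MetricSpace M]

theorem seqDist_nonneg (x y : ℕ → M) : 0 ≤ seqDist x y := tsum_nonneg fun _ => by positivity

theorem seqDist_self (x : ℕ → M) : seqDist x x = 0 := by simp [seqDist]

theorem seqDist_comm (x y : ℕ → M) : seqDist x y = seqDist y x := by
  simp only [seqDist, dist_comm]

theorem summable_half_pow_succ_mul (c : ℝ) : Summable fun k : ℕ => (1 / 2 : ℝ) ^ (k + 1) * c :=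
  ((summable_nat_add_iff 1).2 summable_geometric_two).mul_right c

theorem WeakWalters.exists_forall_le {f : C(ℕ → M, ℝ)} (hf : WeakWalters f) {ε : ℝ} (hε : 0 < ε) :
    ∃ δ > 0, ∀ x y, seqDist x y < δ → ∀ (n : ℕ) (a : Fin n → M),
      birkhoffSum shift f n (concat a x) - birkhoffSum shift f n (concat a y) ≤ ε := by
  have h1 : ∀ᶠ p : (ℕ → M) × (ℕ → M) in
      comap (fun p : (ℕ → M) × (ℕ → M) => seqDist p.1 p.2) (𝓝 0), walters f p.1 p.2 < (ε : EReal) :=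
    hf.eventually (gt_mem_nhds (by exact_mod_cast hε))
  rw [eventually_comap, Metric.eventually_nhds_iff] at h1
  obtain ⟨δ, hδ, h⟩ := h1
  refine ⟨δ, hδ, fun x y hxy n a => ?_⟩
  rcases Nat.eq_zero_or_pos n with rfl | hn
  · simpa using hε.le
  · have h2 := h (y := seqDist x y)
      (by rwa [Real.dist_eq, sub_zero, abs_of_nonneg (seqDist_nonneg x y)]) (x, y) rfl
    have h3 := (le_iSup₂_of_le (f := fun (n : ℕ) (_ : 1 ≤ n) => ⨆ a : Fin n → M,
      ((birkhoffSum shift f n (concat a x) - birkhoffSum shift f n (concat a y) : ℝ) : EReal))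
      n hn (le_iSup _ a)).trans h2.le
    exact_mod_cast h3

variable [CompactSpace M]

theorem seqDist_term_le (x y : ℕ → M) (k : ℕ) :
    (1 / 2 : ℝ) ^ (k + 1) * dist (x k) (y k) ≤
      (1 / 2 : ℝ) ^ (k + 1) * Metric.diam (Set.univ : Set M) := by
  gcongr
  exact Metric.dist_le_diam_of_mem isCompact_univ.isBounded trivial trivial

theorem summable_seqDist (x y : ℕ → M) :
    Summable fun k : ℕ => (1 / 2 : ℝ) ^ (k + 1) * dist (x k) (y k) :=
  Summable.of_nonneg_of_le (fun _ => by positivity) (seqDist_term_le x y)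
    (summable_half_pow_succ_mul _)

theorem continuous_seqDist : Continuous fun p : (ℕ → M) × (ℕ → M) => seqDist p.1 p.2 := by
  refine continuous_tsum (fun k => ?_)
    (summable_half_pow_succ_mul (Metric.diam (Set.univ : Set M))) fun k p => ?_
  · fun_prop
  · rw [Real.norm_of_nonneg (by positivity)]
    exact seqDist_term_le p.1 p.2 k

theorem eq_of_seqDist_eq_zero {x y : ℕ → M} (h : seqDist x y = 0) : x = y := by
  have h0 := (summable_seqDist x y).hasSum
  rw [show (∑' k : ℕ, (1 / 2 : ℝ) ^ (k + 1) * dist (x k) (y k)) = 0 from h,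
    hasSum_zero_iff_of_nonneg fun _ => by positivity] at h0
  funext k
  simpa using congrFun h0 k

theorem seqDist_cons (b : M) (x y : ℕ → M) :
    seqDist (cons b x) (cons b y) = 1 / 2 * seqDist x y := by
  unfold seqDist
  rw [(summable_seqDist (cons b x) (cons b y)).tsum_eq_zero_add, ← tsum_mul_left]
  simp only [cons, dist_self, mul_zero, zero_add]
  exact tsum_congr fun k => by ring

theorem seqDist_concat {n : ℕ} (a : Fin n → M) (x y : ℕ → M) :
    seqDist (concat a x) (concat a y) = (1 / 2) ^ n * seqDist x y := by
  induction n generalizing x y with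
  | zero => simp [concat_zero]
  | succ n ih =>
    rw [← Fin.snoc_init_self a, concat_snoc, concat_snoc, ih, seqDist_cons]
    ring

theorem seqDist_concat_le {n : ℕ} (a : Fin n → M) (x y : ℕ → M) :
    seqDist (concat a x) (concat a y) ≤ seqDist x y := by
  rw [seqDist_concat]
  exact mul_le_of_le_one_left (seqDist_nonneg x y) (pow_le_one₀ (by norm_num) (by norm_num))

/-- Continuous functions on the sequence space are uniformly continuous for `seqDist`. -/
theorem exists_seqDist_lt_imp_sub_lt (u : C(ℕ → M, ℝ)) {ε : ℝ} (hε : 0 < ε) :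
    ∃ δ > 0, ∀ x y, seqDist x y < δ → u x - u y < ε := by
  let s : Set ((ℕ → M) × (ℕ → M)) := {p | ε ≤ u p.1 - u p.2}
  have hs : IsCompact s := (isClosed_le continuous_const (by fun_prop)).isCompact
  rcases s.eq_empty_or_nonempty with he | hne
  · refine ⟨1, one_pos, fun x y _ => ?_⟩
    by_contra h
    exact (he ▸ Set.notMem_empty (x, y)) (not_lt.1 h : (x, y) ∈ s)
  · obtain ⟨p, hp, hmin⟩ := hs.exists_isMinOn hne continuous_seqDist.continuousOn
    refine ⟨seqDist p.1 p.2, (seqDist_nonneg _ _).lt_of_ne fun h => ?_, fun x y hxy => ?_⟩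
    · have h1 : ε ≤ u p.1 - u p.2 := hp
      rw [eq_of_seqDist_eq_zero h.symm, sub_self] at h1
      exact hε.not_ge h1
    · by_contra h
      exact hxy.not_ge (isMinOn_iff.1 hmin (x, y) (not_lt.1 h))

/-- Moving the last letter of the word into both tails halves their distance and costs at most `2 *
‖f‖`. By compactness a fixed number `N` of moves brings any two tails within `δ`; a word that runs
out earlier contributes nothing more. -/
theorem WeakWalters.exists_bound {f : C(ℕ → M, ℝ)} (hf : WeakWalters f) :
    ∃ K : ℝ, ∀ (x y : ℕ → M) (n : ℕ) (a : Fin n → M),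
      birkhoffSum shift f n (concat a x) - birkhoffSum shift f n (concat a y) ≤ K := by
  obtain ⟨δ, hδ, h⟩ := hf.exists_forall_le one_pos
  obtain ⟨D, hD⟩ : ∃ D : ℝ, ∀ x y : ℕ → M, seqDist x y ≤ D := by
    obtain ⟨D, hD⟩ := (isCompact_range (continuous_seqDist (M := M))).bddAbove
    exact ⟨D, fun x y => hD ⟨(x, y), rfl⟩⟩
  obtain ⟨N, hN⟩ : ∃ N : ℕ, (1 / 2 : ℝ) ^ N * D < δ := by
    have : Tendsto (fun N : ℕ => (1 / 2 : ℝ) ^ N * D) atTop (𝓝 (0 * D)) :=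
      (tendsto_pow_atTop_nhds_zero_of_lt_one (by norm_num) (by norm_num)).mul_const D
    rw [zero_mul] at this
    exact (this.eventually (gt_mem_nhds hδ)).exists
  have key : ∀ (j : ℕ) (x y : ℕ → M), (1 / 2 : ℝ) ^ j * seqDist x y < δ →
      ∀ (n : ℕ) (a : Fin n → M),
      birkhoffSum shift f n (concat a x) - birkhoffSum shift f n (concat a y) ≤
        1 + 2 * j * ‖f‖ := by
    intro j
    induction j with
    | zero =>
      intro x y hxy n a
      simpa using h x y (by simpa using hxy) n a
    | succ j ih =>
      intro x y hxy n a
      cases n with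
      | zero =>
        simp only [birkhoffSum_zero, sub_self]
        positivity
      | succ n =>
        rw [← Fin.snoc_init_self a, birkhoffSum_concat_snoc, birkhoffSum_concat_snoc]
        have h1 := ih (cons (a (Fin.last n)) x) (cons (a (Fin.last n)) y)
          (by rw [seqDist_cons]; calc _ = (1 / 2 : ℝ) ^ (j + 1) * seqDist x y := by ring
                _ < δ := hxy) n (Fin.init a)
        have h2 := abs_le.1 (f.norm_coe_le_norm (cons (a (Fin.last n)) x))
        have h3 := abs_le.1 (f.norm_coe_le_norm (cons (a (Fin.last n)) y))
        push_cast
        linarith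
  exact ⟨1 + 2 * N * ‖f‖, fun x y n a => key N x y
    ((mul_le_mul_of_nonneg_left (hD x y) (by positivity)).trans_lt hN) n a⟩

end Distance

/-! ### Iterates of the Ruelle operator -/

section Operator

variable {M : Type*} [MetricSpace M] [CompactSpace M] [MeasurableSpace M] [BorelSpace M]
  (μ : Measure M) [IsProbabilityMeasure μ] (f : C(ℕ → M, ℝ))

theorem ruelle_pow_succ_apply (n : ℕ) (φ : C(ℕ → M, ℝ)) (x : ℕ → M) :
    (ruelle μ f ^ (n + 1)) φ x =
      ∫ a, Real.exp (f (cons a x)) * (ruelle μ f ^ n) φ (cons a x) ∂μ := by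
  rw [pow_succ']
  rfl

/-- Replaces the formula for the iterate as an integral over words of length `n`, without product
measures. The constant `c` varies in the induction because it absorbs the ratio of the weights of
the last letter. -/
theorem ruelle_pow_le_mul_of_forall_word (n : ℕ) {φ ψ : C(ℕ → M, ℝ)} {x y : ℕ → M} {c : ℝ}
    (h : ∀ a : Fin n → M, Real.exp (birkhoffSum shift f n (concat a x)) * φ (concat a x) ≤
      c * (Real.exp (birkhoffSum shift f n (concat a y)) * ψ (concat a y))) :
    (ruelle μ f ^ n) φ x ≤ c * (ruelle μ f ^ n) ψ y := by
  induction n generalizing x y c with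
  | zero => simpa [concat_zero] using h Fin.elim0
  | succ n ih =>
    rw [ruelle_pow_succ_apply, ruelle_pow_succ_apply, ← integral_const_mul]
    refine integral_mono (integrable_integrand μ f _ x)
      ((integrable_integrand μ f _ y).const_mul c) fun b => ?_
    have h1 : (ruelle μ f ^ n) φ (cons b x) ≤
        (c * Real.exp (f (cons b y) - f (cons b x))) * (ruelle μ f ^ n) ψ (cons b y) := by
      refine ih fun a => ?_
      have h2 := h (Fin.snoc (α := fun _ => M) a b)
      rw [birkhoffSum_concat_snoc, birkhoffSum_concat_snoc, concat_snoc, concat_snoc] at h2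
      have h3 := mul_le_mul_of_nonneg_left h2 (Real.exp_pos (-f (cons b x))).le
      simp only [Real.exp_sub, Real.exp_neg, Real.exp_add] at h3 ⊢
      field_simp at h3 ⊢
      linarith
    refine (mul_le_mul_of_nonneg_left h1 (Real.exp_pos (f (cons b x))).le).trans_eq ?_
    rw [Real.exp_sub]
    field_simp

theorem ruelle_pow_mono (n : ℕ) {φ ψ : C(ℕ → M, ℝ)} (h : φ ≤ ψ) :
    (ruelle μ f ^ n) φ ≤ (ruelle μ f ^ n) ψ := fun x => by
  change (ruelle μ f ^ n) φ x ≤ (ruelle μ f ^ n) ψ x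
  rw [← one_mul ((ruelle μ f ^ n) ψ x)]
  refine ruelle_pow_le_mul_of_forall_word μ f n fun a => ?_
  rw [one_mul]
  exact mul_le_mul_of_nonneg_left (h _) (Real.exp_pos _).le

theorem ruelle_pow_nonneg (n : ℕ) {φ : C(ℕ → M, ℝ)} (h : 0 ≤ φ) : 0 ≤ (ruelle μ f ^ n) φ := by
  simpa using ruelle_pow_mono μ f n h

/-- A continuous nonnegative integrand with zero integral vanishes everywhere when `μ` has full
support; this applies one letter at a time. -/
theorem eq_zero_of_ruelle_pow_eq_zero [μ.IsOpenPosMeasure] (n : ℕ) {φ : C(ℕ → M, ℝ)} (hφ : 0 ≤ φ)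
    {x : ℕ → M} (h : (ruelle μ f ^ n) φ x = 0) (a : Fin n → M) : φ (concat a x) = 0 := by
  induction n generalizing x with
  | zero => simpa [concat_zero] using h
  | succ n ih =>
    rw [← Fin.snoc_init_self a, concat_snoc]
    refine ih ?_ _
    by_contra hne
    rw [ruelle_pow_succ_apply] at h
    refine h.not_gt (Continuous.integral_pos_of_hasCompactSupport_nonneg_nonzero
      (x := a (Fin.last n)) ((continuous_integrand f _).comp (Continuous.prodMk_right x))
      (HasCompactSupport.of_compactSpace _)
      (fun b => mul_nonneg (Real.exp_pos _).le (ruelle_pow_nonneg μ f n hφ _))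
      (mul_ne_zero (Real.exp_pos _).ne' hne))

end Operator

end RuelleOp

/-! ### Almost additive sequences and Riesz representation -/

/-- A sequence of reals that is additive up to a bounded error is at bounded distance from a
linear one. -/
theorem exists_forall_abs_sub_mul_le {a : ℕ → ℝ} {K : ℝ}
    (h : ∀ m n, |a (m + n) - a m - a n| ≤ K) : ∃ l : ℝ, ∀ n, |a n - n * l| ≤ K := by
  have h0 : |a 0| ≤ K := by simpa using h 0 0
  have hlow : ∀ n : ℕ, n * (a 1 - K) - K ≤ a n := by
    intro n
    induction n with
    | zero => simpa using (abs_le.1 h0).1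
    | succ n ih =>
      have := (abs_le.1 (h n 1)).1
      push_cast
      linarith
  have hupp : ∀ n : ℕ, a n ≤ n * (a 1 + K) + K := by
    intro n
    induction n with
    | zero => simpa using (abs_le.1 h0).2
    | succ n ih =>
      have := (abs_le.1 (h n 1)).2
      push_cast
      linarith
  -- Fekete's lemma applies to both `a + K` and `-a + K`. Their limits are opposite, and each is a
  -- lower bound for its quotients, which gives the two sides of the estimate.
  have hu : Subadditive fun n => a n + K := fun m n => by
    have := (abs_le.1 (h m n)).2
    linarith
  have hv : Subadditive fun n => -a n + K := fun m n => by
    have := (abs_le.1 (h m n)).1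
    linarith
  have hub : BddBelow (Set.range fun n : ℕ => (a n + K) / n) := by
    -- The `0` covers `n = 0`, where the quotient is `0` by convention.
    refine ⟨min 0 (a 1 - K), ?_⟩
    rintro _ ⟨n, rfl⟩
    rcases Nat.eq_zero_or_pos n with rfl | hn
    · simp
    · have hn' : (0 : ℝ) < n := by exact_mod_cast hn
      refine (min_le_right _ _).trans ((le_div_iff₀ hn').2 ?_)
      linarith [hlow n]
  have hvb : BddBelow (Set.range fun n : ℕ => (-a n + K) / n) := by
    refine ⟨min 0 (-a 1 - K), ?_⟩
    rintro _ ⟨n, rfl⟩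
    rcases Nat.eq_zero_or_pos n with rfl | hn
    · simp
    · have hn' : (0 : ℝ) < n := by exact_mod_cast hn
      refine (min_le_right _ _).trans ((le_div_iff₀ hn').2 ?_)
      linarith [hupp n]
  have hsum : hu.lim + hv.lim = 0 := by
    refine tendsto_nhds_unique ((hu.tendsto_lim hub).add (hv.tendsto_lim hvb)) ?_
    refine (tendsto_const_div_atTop_nhds_zero_nat (2 * K)).congr fun n => ?_
    ring
  refine ⟨hu.lim, fun n => ?_⟩
  rcases Nat.eq_zero_or_pos n with rfl | hn
  · simpa using h0
  · have hn' : (0 : ℝ) < n := by exact_mod_cast hn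
    have h1 := (le_div_iff₀ hn').1 (hu.lim_le_div hub hn.ne')
    have h2 := (le_div_iff₀ hn').1 (hv.lim_le_div hvb hn.ne')
    have h3 : hv.lim = -hu.lim := by linarith
    rw [h3] at h2
    rw [abs_le]
    constructor <;> linarith

/-- A positive normalized linear functional on the continuous functions on a compact space is
integration against a Borel probability measure. -/
theorem exists_probabilityMeasure_integral_eq {X : Type*} [TopologicalSpace X] [T2Space X]
    [CompactSpace X] [MeasurableSpace X] [BorelSpace X] (l : C(X, ℝ) →ₗ[ℝ] ℝ)
    (hl : ∀ φ, 0 ≤ φ → 0 ≤ l φ) (hl1 : l 1 = 1) :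
    ∃ ν : ProbabilityMeasure X, ∀ φ : C(X, ℝ), ∫ x, φ x ∂(ν : Measure X) = l φ := by
  let L : CompactlySupportedContinuousMap X ℝ →ₗ[ℝ] ℝ :=
    { toFun := fun φ => l φ.toContinuousMap
      map_add' := fun φ ψ => l.map_add φ.toContinuousMap ψ.toContinuousMap
      map_smul' := fun c φ => l.map_smul c φ.toContinuousMap }
  let P := PositiveLinearMap.mk₀ L fun φ hφ => hl _ (CompactlySupportedContinuousMap.le_def.1 hφ)
  have hP : ∀ φ : C(X, ℝ), ∫ x, φ x ∂(RealRMK.rieszMeasure P) = l φ := fun φ =>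
    RealRMK.integral_rieszMeasure P (CompactlySupportedContinuousMap.continuousMapEquiv φ)
  have h1 : RealRMK.rieszMeasure P Set.univ = 1 := by
    have := hP 1
    rw [hl1] at this
    simpa [Measure.real, ENNReal.toReal_eq_one_iff] using this
  exact ⟨⟨RealRMK.rieszMeasure P, ⟨h1⟩⟩, hP⟩

namespace RuelleOp

/-! ### Compactness from a multiplicative modulus of continuity -/

section Compactness

variable {M : Type*} [MetricSpace M] [CompactSpace M]

theorem exists_subseq_tendsto_of_le_mul (u : ℕ → C(ℕ → M, ℝ)) (B : ℝ) (h0 : ∀ n x, 0 ≤ u n x)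
    (hB : ∀ n x, u n x ≤ B)
    (h : ∀ c > 1, ∃ δ > 0, ∀ x y, seqDist x y < δ → ∀ n, u n x ≤ c * u n y) :
    ∃ (w : C(ℕ → M, ℝ)) (k : ℕ → ℕ), StrictMono k ∧ Tendsto (fun n => u (k n)) atTop (𝓝 w) := by
  let e := BoundedContinuousFunction.mkOfCompact (α := ℕ → M) (β := ℝ)
  have hc : IsCompact (closure (Set.range fun n => e (u n))) := by
    refine BoundedContinuousFunction.arzela_ascoli (Set.Icc 0 B) isCompact_Icc _ ?_ ?_
    · rintro _ x ⟨n, rfl⟩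
      exact ⟨h0 n x, hB n x⟩
    · intro x
      rw [Metric.equicontinuousAt_iff_right]
      intro ε hε
      have hB0 : 0 ≤ B := (h0 0 x).trans (hB 0 x)
      -- For functions with values in `[0, B]`, this ratio keeps the difference below `ε`; `B + 1`
      -- avoids division by zero.
      obtain ⟨δ, hδ, hxy⟩ := h (1 + ε / (B + 1)) (by have : 0 < ε / (B + 1) := by positivity
                                                     linarith)
      have hnear : ∀ᶠ y in 𝓝 x, seqDist x y < δ := by
        have hcont : Continuous fun y => seqDist x y :=
          continuous_seqDist.comp (Continuous.prodMk_right x)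
        exact hcont.continuousAt.eventually (gt_mem_nhds (by simpa [seqDist_self] using hδ))
      filter_upwards [hnear] with y hy
      rintro ⟨_, n, rfl⟩
      change dist (u n x) (u n y) < ε
      have hεB : ε / (B + 1) * B < ε := by
        rw [div_mul_eq_mul_div, div_lt_iff₀ (by positivity)]
        linarith
      have h1 := hxy x y hy n
      have h2 := hxy y x (by rwa [seqDist_comm]) n
      have h3 : ε / (B + 1) * u n x ≤ ε / (B + 1) * B :=
        mul_le_mul_of_nonneg_left (hB n x) (by positivity)
      have h4 : ε / (B + 1) * u n y ≤ ε / (B + 1) * B :=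
        mul_le_mul_of_nonneg_left (hB n y) (by positivity)
      rw [Real.dist_eq, abs_lt]
      constructor <;> linarith
  obtain ⟨w, -, k, hk, hw⟩ := hc.tendsto_subseq fun n => subset_closure (Set.mem_range_self n)
  refine ⟨w.toContinuousMap, k, hk, ?_⟩
  rw [tendsto_iff_dist_tendsto_zero] at hw ⊢
  refine hw.congr fun n => ?_
  rw [← BoundedContinuousFunction.dist_toContinuousMap]
  rfl

end Compactness

/-! ### Distortion and growth rate of the iterates -/

section Growth

variable {M : Type*} [MetricSpace M] [CompactSpace M] [MeasurableSpace M] [BorelSpace M]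
  (μ : Measure M) [IsProbabilityMeasure μ] {f : C(ℕ → M, ℝ)}

/-- Half of `log c` is spent on the Birkhoff sums, half on `log ψ`. Since prefixing never increases
distance, `δ` is independent of `n`. -/
theorem WeakWalters.ruelle_pow_le_mul (hf : WeakWalters f) {ψ : C(ℕ → M, ℝ)} (hψ : ∀ x, 0 < ψ x)
    {c : ℝ} (hc : 1 < c) :
    ∃ δ > 0, ∀ x y, seqDist x y < δ → ∀ n, (ruelle μ f ^ n) ψ x ≤ c * (ruelle μ f ^ n) ψ y := by
  have hlog : 0 < Real.log c / 2 := half_pos (Real.log_pos hc)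
  let u : C(ℕ → M, ℝ) := ⟨fun x => Real.log (ψ x), ψ.continuous.log fun x => (hψ x).ne'⟩
  obtain ⟨δ₁, hδ₁, h₁⟩ := hf.exists_forall_le hlog
  obtain ⟨δ₂, hδ₂, h₂⟩ := exists_seqDist_lt_imp_sub_lt u hlog
  refine ⟨min δ₁ δ₂, lt_min hδ₁ hδ₂, fun x y hxy n =>
    ruelle_pow_le_mul_of_forall_word μ f n fun a => ?_⟩
  have h3 := h₁ x y (hxy.trans_le (min_le_left _ _)) n a
  have h4 : Real.log (ψ (concat a x)) - Real.log (ψ (concat a y)) < Real.log c / 2 :=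
    h₂ _ _ ((seqDist_concat_le a x y).trans_lt (hxy.trans_le (min_le_right _ _)))
  rw [← Real.exp_log (hψ (concat a x)), ← Real.exp_log (hψ (concat a y)),
    ← Real.exp_log (zero_lt_one.trans hc), ← Real.exp_add, ← Real.exp_add, ← Real.exp_add,
    Real.exp_le_exp]
  linarith

variable [μ.IsOpenPosMeasure]

theorem ruelle_pow_pos (f : C(ℕ → M, ℝ)) (n : ℕ) {φ : C(ℕ → M, ℝ)} (hφ : ∀ x, 0 < φ x)
    (x : ℕ → M) : 0 < (ruelle μ f ^ n) φ x := by
  have h0 : 0 ≤ φ := fun x => (hφ x).le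
  refine (ruelle_pow_nonneg μ f n h0 x).lt_of_ne fun h => ?_
  exact (hφ _).ne' (eq_zero_of_ruelle_pow_eq_zero μ f n h0 h.symm fun _ => x 0)

/-- The exponential growth rate of the iterates of the Ruelle operator is sharp up to a
multiplicative constant. -/
theorem WeakWalters.exists_growth_rate (hf : WeakWalters f) :
    ∃ lam > 0, ∃ C > 0, ∀ n x, C⁻¹ * lam ^ n ≤ (ruelle μ f ^ n) 1 x ∧
      (ruelle μ f ^ n) 1 x ≤ C * lam ^ n := by
  obtain ⟨K, hK⟩ := hf.exists_bound
  have hcmp : ∀ n x y, (ruelle μ f ^ n) 1 x ≤ Real.exp K * (ruelle μ f ^ n) 1 y := fun n x y =>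
    ruelle_pow_le_mul_of_forall_word μ f n fun a => by
      simp only [ContinuousMap.one_apply, mul_one]
      rw [← Real.exp_add, Real.exp_le_exp]
      linarith [hK x y n a]
  have hpos : ∀ n x, 0 < (ruelle μ f ^ n) 1 x := fun n x =>
    ruelle_pow_pos μ f n (fun _ => one_pos) x
  obtain ⟨m₀⟩ := nonempty_of_isProbabilityMeasure μ
  let z : ℕ → M := fun _ => m₀
  have hadd : ∀ m n, |Real.log ((ruelle μ f ^ (m + n)) 1 z) - Real.log ((ruelle μ f ^ m) 1 z)
      - Real.log ((ruelle μ f ^ n) 1 z)| ≤ K := by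
    intro m n
    have hsplit : (ruelle μ f ^ (m + n)) 1 z = (ruelle μ f ^ m) ((ruelle μ f ^ n) 1) z := by
      rw [pow_add]
      rfl
    have hup : (ruelle μ f ^ (m + n)) 1 z ≤
        (Real.exp K * (ruelle μ f ^ n) 1 z) * (ruelle μ f ^ m) 1 z := by
      rw [hsplit]
      refine ruelle_pow_le_mul_of_forall_word μ f m fun a => ?_
      have := mul_le_mul_of_nonneg_left (hcmp n (concat a z) z)
        (Real.exp_pos (birkhoffSum shift f m (concat a z))).le
      simp only [ContinuousMap.one_apply, mul_one]
      linarith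
    have hlo : (ruelle μ f ^ m) 1 z ≤
        (Real.exp K / (ruelle μ f ^ n) 1 z) * (ruelle μ f ^ (m + n)) 1 z := by
      rw [hsplit]
      refine ruelle_pow_le_mul_of_forall_word μ f m fun a => ?_
      have := mul_le_mul_of_nonneg_left (hcmp n z (concat a z))
        (Real.exp_pos (birkhoffSum shift f m (concat a z))).le
      simp only [ContinuousMap.one_apply, mul_one]
      rw [div_mul_eq_mul_div, le_div_iff₀ (hpos n z)]
      linarith
    have h1 := Real.log_le_log (hpos _ z) hup
    have h2 := Real.log_le_log (hpos _ z) hlo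
    rw [Real.log_mul (mul_pos (Real.exp_pos K) (hpos n z)).ne' (hpos m z).ne',
      Real.log_mul (Real.exp_pos K).ne' (hpos n z).ne', Real.log_exp] at h1
    rw [Real.log_mul (div_pos (Real.exp_pos K) (hpos n z)).ne' (hpos _ z).ne',
      Real.log_div (Real.exp_pos K).ne' (hpos n z).ne', Real.log_exp] at h2
    rw [abs_le]
    constructor <;> linarith
  obtain ⟨l, hl⟩ := 
    exists_forall_abs_sub_mul_le (a := fun n => Real.log ((ruelle μ f ^ n) 1 z)) hadd
  -- One `K` pays for passing from `x` to `z`, the other for the distance of the logarithm from `n *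
  -- l`.
  refine ⟨Real.exp l, Real.exp_pos l, Real.exp (2 * K), Real.exp_pos _, fun n x => ?_⟩
  have h1 := Real.log_le_log (hpos n x) (hcmp n x z)
  have h2 := Real.log_le_log (hpos n z) (hcmp n z x)
  rw [Real.log_mul (Real.exp_pos K).ne' (hpos n _).ne', Real.log_exp] at h1 h2
  have h3 := abs_le.1 (hl n)
  rw [← Real.exp_log (hpos n x), ← Real.exp_nat_mul, ← Real.exp_neg, ← Real.exp_add,
    ← Real.exp_add, Real.exp_le_exp, Real.exp_le_exp]
  constructor <;> linarith

end Growth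

/-! ### Fixed point and convergence of the normalized iterates -/

section Convergence

variable {M : Type*} [MetricSpace M] [CompactSpace M] [MeasurableSpace M] [BorelSpace M]
  (μ : Measure M) [IsProbabilityMeasure μ]

theorem smul_ruelle_pow_apply (f : C(ℕ → M, ℝ)) (lam : ℝ) (n : ℕ) (φ : C(ℕ → M, ℝ)) :
    ((lam⁻¹ • ruelle μ f) ^ n) φ = (lam ^ n)⁻¹ • (ruelle μ f ^ n) φ := by
  rw [smul_pow, inv_pow]
  rfl

variable {f : C(ℕ → M, ℝ)} {lam C : ℝ}

theorem smul_ruelle_pow_mono (hlam : 0 < lam) (n : ℕ) {φ ψ : C(ℕ → M, ℝ)} (h : φ ≤ ψ) :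
    ((lam⁻¹ • ruelle μ f) ^ n) φ ≤ ((lam⁻¹ • ruelle μ f) ^ n) ψ := by
  rw [smul_ruelle_pow_apply, smul_ruelle_pow_apply]
  exact fun x => mul_le_mul_of_nonneg_left (ruelle_pow_mono μ f n h x)
    (inv_nonneg.2 (pow_nonneg hlam.le n))

theorem smul_ruelle_pow_nonneg (hlam : 0 < lam) (n : ℕ) {φ : C(ℕ → M, ℝ)} (h : 0 ≤ φ) :
    0 ≤ ((lam⁻¹ • ruelle μ f) ^ n) φ := by
  simpa only [map_zero] using smul_ruelle_pow_mono (f := f) μ hlam n h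

theorem norm_smul_ruelle_pow_le (hlam : 0 < lam) (hC : 0 < C)
    (hup : ∀ n x, (ruelle μ f ^ n) 1 x ≤ C * lam ^ n) (n : ℕ) (φ : C(ℕ → M, ℝ)) :
    ‖((lam⁻¹ • ruelle μ f) ^ n) φ‖ ≤ C * ‖φ‖ := by
  have key : ∀ ψ : C(ℕ → M, ℝ), ‖ψ‖ ≤ ‖φ‖ → ∀ x,
      ((lam⁻¹ • ruelle μ f) ^ n) ψ x ≤ C * ‖φ‖ := by
    intro ψ hψ x
    have h1 : ψ ≤ ‖φ‖ • (1 : C(ℕ → M, ℝ)) := fun x => by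
      simpa using ((le_abs_self _).trans (ψ.norm_coe_le_norm x)).trans hψ
    refine (smul_ruelle_pow_mono μ hlam n h1 x).trans ?_
    have h2 : (lam ^ n)⁻¹ * (ruelle μ f ^ n) 1 x ≤ C := by
      rw [inv_mul_le_iff₀ (pow_pos hlam n), mul_comm]
      exact hup n x
    rw [map_smul, smul_ruelle_pow_apply]
    change ‖φ‖ * ((lam ^ n)⁻¹ * (ruelle μ f ^ n) 1 x) ≤ C * ‖φ‖
    rw [mul_comm]
    exact mul_le_mul_of_nonneg_right h2 (norm_nonneg _)
  refine (ContinuousMap.norm_le _ (by positivity)).2 fun x => abs_le.2 ⟨?_, key φ le_rfl x⟩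
  have h3 := key (-φ) (norm_neg φ).le x
  rw [map_neg, ContinuousMap.neg_apply] at h3
  linarith

theorem smul_ruelle_pow_le_mul (hlam : 0 < lam) {n : ℕ} {ψ : C(ℕ → M, ℝ)} {x y : ℕ → M} {c : ℝ}
    (h : (ruelle μ f ^ n) ψ x ≤ c * (ruelle μ f ^ n) ψ y) :
    ((lam⁻¹ • ruelle μ f) ^ n) ψ x ≤ c * ((lam⁻¹ • ruelle μ f) ^ n) ψ y := by
  simp only [smul_ruelle_pow_apply, ContinuousMap.smul_apply, smul_eq_mul]
  rw [mul_left_comm]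
  exact mul_le_mul_of_nonneg_left h (inv_nonneg.2 (pow_nonneg hlam.le n))

/-- The Cesàro averages of `T ^ k 1` lie in `[C⁻¹, C]` and share a modulus of continuity, so a
subsequence converges. The telescoping defect `T (A n) - A n` is of order `1 / n`, so the limit is
fixed. -/
theorem WeakWalters.exists_eigenfunction (hf : WeakWalters f) (hlam : 0 < lam) (hC : 0 < C)
    (hlow : ∀ n x, C⁻¹ * lam ^ n ≤ (ruelle μ f ^ n) 1 x)
    (hup : ∀ n x, (ruelle μ f ^ n) 1 x ≤ C * lam ^ n) :
    ∃ h : C(ℕ → M, ℝ), (∀ x, 0 < h x) ∧ (lam⁻¹ • ruelle μ f) h = h := by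
  set T := lam⁻¹ • ruelle μ f with hT
  have hTlow : ∀ n x, C⁻¹ ≤ (T ^ n) 1 x := fun n x => by
    rw [hT, smul_ruelle_pow_apply]
    change C⁻¹ ≤ (lam ^ n)⁻¹ * (ruelle μ f ^ n) 1 x
    rw [le_inv_mul_iff₀ (pow_pos hlam n), mul_comm]
    exact hlow n x
  have hTup : ∀ n x, (T ^ n) 1 x ≤ C := fun n x => by
    rw [hT, smul_ruelle_pow_apply]
    change (lam ^ n)⁻¹ * (ruelle μ f ^ n) 1 x ≤ C
    rw [inv_mul_le_iff₀ (pow_pos hlam n), mul_comm]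
    exact hup n x
  let A : ℕ → C(ℕ → M, ℝ) := fun n => ((n : ℝ) + 1)⁻¹ • ∑ k ∈ Finset.range (n + 1), (T ^ k) 1
  have hA : ∀ n x, A n x = ((n : ℝ) + 1)⁻¹ * ∑ k ∈ Finset.range (n + 1), (T ^ k) 1 x := by
    intro n x
    simp [A]
  have hpos : ∀ n : ℕ, (0 : ℝ) < n + 1 := fun n => by positivity
  have hAlow : ∀ n x, C⁻¹ ≤ A n x := by
    intro n x
    rw [hA, le_inv_mul_iff₀ (hpos n)]
    have := Finset.card_nsmul_le_sum (Finset.range (n + 1)) (fun k => (T ^ k) 1 x) C⁻¹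
      fun k _ => hTlow k x
    simpa using this
  have hAup : ∀ n x, A n x ≤ C := by
    intro n x
    rw [hA, inv_mul_le_iff₀ (hpos n)]
    have := Finset.sum_le_card_nsmul (Finset.range (n + 1)) (fun k => (T ^ k) 1 x) C
      fun k _ => hTup k x
    simpa using this
  have hAeq : ∀ c > 1, ∃ δ > 0, ∀ x y, seqDist x y < δ → ∀ n, A n x ≤ c * A n y := by
    intro c hc
    obtain ⟨δ, hδ, h⟩ := hf.ruelle_pow_le_mul μ (ψ := 1) (fun _ => one_pos) hc
    refine ⟨δ, hδ, fun x y hxy n => ?_⟩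
    rw [hA, hA, mul_left_comm, Finset.mul_sum _ _ c]
    exact mul_le_mul_of_nonneg_left (Finset.sum_le_sum fun k _ =>
      smul_ruelle_pow_le_mul μ hlam (h x y hxy k)) (inv_nonneg.2 (hpos n).le)
  obtain ⟨h, k, hk, hlim⟩ := exists_subseq_tendsto_of_le_mul A C
    (fun n x => (inv_nonneg.2 hC.le).trans (hAlow n x)) hAup hAeq
  refine ⟨h, fun x => ?_, ?_⟩
  · have hx : Tendsto (fun n => A (k n) x) atTop (𝓝 (h x)) :=
      ((continuous_eval_const x).tendsto h).comp hlim
    exact (inv_pos.2 hC).trans_le (ge_of_tendsto' hx fun n => hAlow _ x)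
  · have hdiff : ∀ n, T (A n) - A n = ((n : ℝ) + 1)⁻¹ • ((T ^ (n + 1)) 1 - 1) := by
      intro n
      have h1 : ∀ j, T ((T ^ j) 1) = (T ^ (j + 1)) 1 := fun j => by
        rw [pow_succ']
        rfl
      simp only [A]
      rw [map_smul, map_sum, ← smul_sub, Finset.sum_congr rfl fun j _ => h1 j,
        ← Finset.sum_sub_distrib, Finset.sum_range_sub fun j => (T ^ j) 1, pow_zero]
      rfl
    have hnorm : ∀ n, ‖T (A n) - A n‖ ≤ (C * ‖(1 : C(ℕ → M, ℝ))‖ + ‖(1 : C(ℕ → M, ℝ))‖) *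
        (1 / ((n : ℝ) + 1)) := by
      intro n
      rw [hdiff, norm_smul, Real.norm_of_nonneg (inv_nonneg.2 (hpos n).le), mul_comm, one_div]
      exact mul_le_mul_of_nonneg_right (norm_sub_le_of_le
        (norm_smul_ruelle_pow_le μ hlam hC hup _ _) le_rfl)
        (inv_nonneg.2 (hpos n).le)
    have hz : Tendsto (fun n => T (A n) - A n) atTop (𝓝 0) := by
      refine squeeze_zero_norm hnorm ?_
      simpa using tendsto_one_div_add_atTop_nhds_zero_nat.const_mul
        (C * ‖(1 : C(ℕ → M, ℝ))‖ + ‖(1 : C(ℕ → M, ℝ))‖)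
    exact sub_eq_zero.1 (tendsto_nhds_unique (((T.continuous.tendsto h).comp hlim).sub hlim)
      (hz.comp hk.tendsto_atTop))

variable [μ.IsOpenPosMeasure]

/-- A continuous function `w ≤ S • h` all of whose iterates touch the fixed function `S • h` of the
normalized operator equals `S • h`. -/
theorem eq_smul_of_forall_exists_eq (hlam : 0 < lam) {h w : C(ℕ → M, ℝ)}
    (hh : (lam⁻¹ • ruelle μ f) h = h) {S : ℝ} (hw : w ≤ S • h)
    (hS : ∀ m : ℕ, ∃ x, ((lam⁻¹ • ruelle μ f) ^ m) w x = S * h x) : w = S • h := by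
  have hfix : ∀ m : ℕ, ((lam⁻¹ • ruelle μ f) ^ m) h = h := by
    intro m
    induction m with
    | zero => rfl
    | succ m ih =>
      rw [pow_succ]
      exact (congrArg _ hh).trans ih
  have hzero : ∀ (m : ℕ), ∃ x, ∀ a : Fin m → M, (S • h - w) (concat a x) = 0 := by
    intro m
    obtain ⟨x, hx⟩ := hS m
    refine ⟨x, eq_zero_of_ruelle_pow_eq_zero μ f m (sub_nonneg.2 hw) ?_⟩
    have h1 : ((lam⁻¹ • ruelle μ f) ^ m) (S • h - w) x = 0 := by
      rw [map_sub, map_smul, hfix]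
      change S * h x - ((lam⁻¹ • ruelle μ f) ^ m) w x = 0
      rw [hx, sub_self]
    rw [smul_ruelle_pow_apply] at h1
    exact (mul_eq_zero.1 h1).resolve_left (inv_ne_zero (pow_pos hlam m).ne')
  choose x hx using hzero
  ext z
  -- The base point `x m` may change with `m`: only the first `m` coordinates matter in the limit.
  have hlim : Tendsto (fun m => concat (fun i : Fin m => z i) (x m)) atTop (𝓝 z) := by
    rw [tendsto_pi_nhds]
    intro k
    refine tendsto_const_nhds.congr' ?_
    filter_upwards [eventually_gt_atTop k] with m hm
    simp [concat, hm]
  have h1 := ((S • h - w).continuous.tendsto z).comp hlim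
  have h2 : (S • h - w) z = 0 := by
    refine tendsto_nhds_unique h1 ?_
    simp only [Function.comp_def, hx, tendsto_const_nhds]
  exact (sub_eq_zero.1 h2).symm

theorem WeakWalters.exists_tendsto_of_pos (hf : WeakWalters f) (hlam : 0 < lam) (hC : 0 < C)
    (hup : ∀ n x, (ruelle μ f ^ n) 1 x ≤ C * lam ^ n) {h : C(ℕ → M, ℝ)} (hh0 : ∀ x, 0 < h x)
    (hh : (lam⁻¹ • ruelle μ f) h = h) {ψ : C(ℕ → M, ℝ)} (hψ : ∀ x, 0 < ψ x) :
    ∃ c : ℝ, Tendsto (fun n => ((lam⁻¹ • ruelle μ f) ^ n) ψ) atTop (𝓝 (c • h)) := by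
  set T := lam⁻¹ • ruelle μ f with hT
  have hne : Nonempty M := nonempty_of_isProbabilityMeasure μ
  have hfix : ∀ m : ℕ, (T ^ m) h = h := by
    intro m
    induction m with
    | zero => rfl
    | succ m ih =>
      rw [pow_succ]
      exact (congrArg _ hh).trans ih
  have hTadd : ∀ m n φ, (T ^ (m + n)) φ = (T ^ m) ((T ^ n) φ) := fun m n φ => by
    rw [pow_add]
    rfl
  have hTψ0 : ∀ n x, 0 ≤ (T ^ n) ψ x := fun n =>
    smul_ruelle_pow_nonneg μ hlam n fun x => (hψ x).le
  -- `‖φ * g‖` is the sup norm weighted by `h`; as `T` is positive and fixes `h`, it does not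
  -- increase along orbits of nonnegative functions.
  let g : C(ℕ → M, ℝ) := ⟨fun x => (h x)⁻¹, h.continuous.inv₀ fun x => (hh0 x).ne'⟩
  have hN : ∀ (φ : C(ℕ → M, ℝ)), φ ≤ ‖φ * g‖ • h := by
    intro φ x
    have h1 : φ x * (h x)⁻¹ ≤ ‖φ * g‖ := (le_abs_self _).trans ((φ * g).norm_coe_le_norm x)
    exact (mul_inv_le_iff₀ (hh0 x)).1 h1
  have hNle : ∀ φ : C(ℕ → M, ℝ), 0 ≤ φ → ∀ m, ‖(T ^ m) φ * g‖ ≤ ‖φ * g‖ := by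
    intro φ hφ m
    refine (ContinuousMap.norm_le _ (norm_nonneg _)).2 fun x => ?_
    have h0 : 0 ≤ (T ^ m) φ x := smul_ruelle_pow_nonneg μ hlam m hφ x
    have h1 : (T ^ m) φ x ≤ ‖φ * g‖ * h x := by
      have := smul_ruelle_pow_mono (f := f) μ hlam m (hN φ) x
      rw [← hT, map_smul, hfix] at this
      exact this
    change ‖(T ^ m) φ x * (h x)⁻¹‖ ≤ ‖φ * g‖
    rw [Real.norm_of_nonneg (mul_nonneg h0 (inv_nonneg.2 (hh0 x).le))]
    exact (mul_inv_le_iff₀ (hh0 x)).2 h1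
  have hanti : Antitone fun n => ‖(T ^ n) ψ * g‖ := antitone_nat_of_succ_le fun n => by
    have := hNle ((T ^ n) ψ) (hTψ0 n) 1
    rwa [← hTadd, add_comm] at this
  obtain ⟨S, hS⟩ : ∃ S, Tendsto (fun n => ‖(T ^ n) ψ * g‖) atTop (𝓝 S) :=
    ⟨_, tendsto_atTop_ciInf hanti ⟨0, by rintro _ ⟨n, rfl⟩; exact norm_nonneg _⟩⟩
  obtain ⟨w, k, hk, hw⟩ := exists_subseq_tendsto_of_le_mul (fun n => (T ^ n) ψ) (C * ‖ψ‖) hTψ0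
    (fun n x => ((le_abs_self _).trans (((T ^ n) ψ).norm_coe_le_norm x)).trans
      (norm_smul_ruelle_pow_le μ hlam hC hup n ψ))
    (fun c hc => by
      obtain ⟨δ, hδ, h⟩ := hf.ruelle_pow_le_mul μ hψ hc
      exact ⟨δ, hδ, fun x y hxy n => smul_ruelle_pow_le_mul μ hlam (h x y hxy n)⟩)
  have hTw : ∀ m, Tendsto (fun n => (T ^ (m + k n)) ψ) atTop (𝓝 ((T ^ m) w)) := by
    intro m
    simp only [hTadd]
    exact ((T ^ m).continuous.tendsto w).comp hw
  -- `T ^ m w` is again a limit point of the orbit of `ψ`, along which the weighted norms tend to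
  -- `S`.
  have hwS : ∀ m, ‖(T ^ m) w * g‖ = S := fun m =>
    tendsto_nhds_unique ((hTw m).mul_const g).norm
      (hS.comp (tendsto_atTop_mono (fun n => Nat.le_add_left (k n) m) hk.tendsto_atTop))
  have hTw0 : ∀ m x, 0 ≤ (T ^ m) w x := fun m x =>
    ge_of_tendsto' (((continuous_eval_const x).tendsto _).comp (hTw m))
      fun n => hTψ0 _ x
  have hwh : w = S • h := by
    refine eq_smul_of_forall_exists_eq μ hlam hh ?_ fun m => ?_
    · have := hN w
      rwa [show ‖w * g‖ = S from hwS 0] at this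
    · obtain ⟨x, -, hx⟩ := isCompact_univ.exists_isMaxOn Set.univ_nonempty
        ((T ^ m) w * g).continuous.continuousOn
      refine ⟨x, ?_⟩
      have hnn : ∀ y, 0 ≤ ((T ^ m) w * g) y := fun y =>
        mul_nonneg (hTw0 m y) (inv_nonneg.2 (hh0 y).le)
      have h1 : ((T ^ m) w * g) x = S := by
        rw [← hwS m]
        refine le_antisymm ((le_abs_self _).trans (((T ^ m) w * g).norm_coe_le_norm x)) ?_
        refine (ContinuousMap.norm_le _ (hnn x)).2 fun y => ?_
        rw [Real.norm_of_nonneg (hnn y)]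
        exact isMaxOn_iff.1 hx y trivial
      exact (mul_inv_eq_iff_eq_mul₀ (hh0 x).ne').1 h1
  refine ⟨S, ?_⟩
  rw [Metric.tendsto_atTop]
  intro ε hε
  rw [hwh, Metric.tendsto_atTop] at hw
  -- One good index suffices: later powers of `T` fix `S • h` and enlarge the error at most `C`
  -- times.
  obtain ⟨j, hj⟩ := hw (ε / C) (by positivity)
  refine ⟨k j, fun n hn => ?_⟩
  obtain ⟨m, rfl⟩ := Nat.exists_eq_add_of_le' hn
  have h1 := hj j le_rfl
  rw [dist_eq_norm, lt_div_iff₀ hC, mul_comm] at h1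
  have h2 := norm_smul_ruelle_pow_le μ hlam hC hup m ((T ^ k j) ψ - S • h)
  rw [← hT, map_sub, map_smul, hfix] at h2
  rw [dist_eq_norm, hTadd]
  exact h2.trans_lt h1

/-- Adding the constant `‖φ‖ + 1` writes `φ` as a difference of two strictly positive functions. -/
theorem WeakWalters.exists_tendsto (hf : WeakWalters f) (hlam : 0 < lam) (hC : 0 < C)
    (hup : ∀ n x, (ruelle μ f ^ n) 1 x ≤ C * lam ^ n) {h : C(ℕ → M, ℝ)} (hh0 : ∀ x, 0 < h x)
    (hh : (lam⁻¹ • ruelle μ f) h = h) (φ : C(ℕ → M, ℝ)) :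
    ∃ c : ℝ, Tendsto (fun n => ((lam⁻¹ • ruelle μ f) ^ n) φ) atTop (𝓝 (c • h)) := by
  have h1 : ∀ x, 0 < (φ + (‖φ‖ + 1) • (1 : C(ℕ → M, ℝ))) x := fun x => by
    have := (abs_le.1 (φ.norm_coe_le_norm x)).1
    simp only [ContinuousMap.add_apply, ContinuousMap.smul_apply, ContinuousMap.one_apply,
      smul_eq_mul, mul_one]
    linarith
  have h2 : ∀ x, 0 < ((‖φ‖ + 1) • (1 : C(ℕ → M, ℝ))) x := fun x => by
    simp only [ContinuousMap.smul_apply, ContinuousMap.one_apply, smul_eq_mul, mul_one]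
    positivity
  obtain ⟨c₁, hc₁⟩ := hf.exists_tendsto_of_pos μ hlam hC hup hh0 hh h1
  obtain ⟨c₂, hc₂⟩ := hf.exists_tendsto_of_pos μ hlam hC hup hh0 hh h2
  refine ⟨c₁ - c₂, ?_⟩
  rw [sub_smul]
  refine (hc₁.sub hc₂).congr fun n => ?_
  rw [← map_sub, add_sub_cancel_right]

end Convergence

end RuelleOp

/-! ### Eigenmeasure and conclusion -/

theorem theorem3 {M : Type*} [MetricSpace M] [CompactSpace M] [MeasurableSpace M] [BorelSpace M]
    (μ : Measure M) [IsProbabilityMeasure μ] [μ.IsOpenPosMeasure]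
    (f : C(ℕ → M, ℝ)) (hf : WeakWalters f) :
    ∃ (lam : ℝ) (h : C(ℕ → M, ℝ)) (ν : ProbabilityMeasure (ℕ → M)),
      0 < lam ∧ (∀ x, 0 < h x) ∧
      ruelle μ f h = lam • h ∧
      ruelleDual μ f (toDual ν) = lam • toDual ν ∧
      (∀ ν' : ProbabilityMeasure (ℕ → M),
        ruelleDual μ f (toDual ν') = lam • toDual ν' → ν' = ν) ∧
      ∀ φ : C(ℕ → M, ℝ),
        Tendsto (fun n : ℕ => ‖(lam ^ n)⁻¹ • (ruelle μ f ^ n) φ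
            - (∫ x, φ x ∂(ν : Measure (ℕ → M))) • h‖) atTop (𝓝 0) := by
  obtain ⟨lam, hlam, C, hC, hbound⟩ := hf.exists_growth_rate μ
  have hup := fun n x => (hbound n x).2
  obtain ⟨h₀, hh₀, hfix₀⟩ := hf.exists_eigenfunction μ hlam hC (fun n x => (hbound n x).1) hup
  obtain ⟨c₀, hc₀⟩ := hf.exists_tendsto μ hlam hC hup hh₀ hfix₀ 1
  set T := lam⁻¹ • ruelle μ f with hT
  obtain ⟨m₀⟩ := nonempty_of_isProbabilityMeasure μ
  let z : ℕ → M := fun _ => m₀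
  have heval : ∀ {u : ℕ → C(ℕ → M, ℝ)} {w : C(ℕ → M, ℝ)}, Tendsto u atTop (𝓝 w) →
      Tendsto (fun n => u n z) atTop (𝓝 (w z)) := fun hu =>
    ((continuous_eval_const z).tendsto _).comp hu
  have hc₀pos : 0 < c₀ := by
    have h1 : C⁻¹ ≤ c₀ * h₀ z := ge_of_tendsto' (heval hc₀) fun n => by
      rw [hT, smul_ruelle_pow_apply]
      change C⁻¹ ≤ (lam ^ n)⁻¹ * (ruelle μ f ^ n) 1 z
      rw [le_inv_mul_iff₀ (pow_pos hlam n), mul_comm]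
      exact (hbound n z).1
    exact pos_of_mul_pos_left ((inv_pos.2 hC).trans_le h1) (hh₀ z).le
  -- Rescaling makes `h` the limit of `T ^ n 1`, so that the functional `l` below takes `1` to `1`.
  obtain ⟨h, hh, hh0⟩ : ∃ h, h = c₀ • h₀ ∧ ∀ x, 0 < h x :=
    ⟨_, rfl, fun x => mul_pos hc₀pos (hh₀ x)⟩
  have hfix : T h = h := by rw [hh, map_smul, hfix₀]
  have heig : ruelle μ f h = lam • h := by
    rw [← inv_smul_eq_iff₀ hlam.ne']
    exact hfix
  choose l hl using hf.exists_tendsto μ hlam hC hup hh0 hfix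
  have huniq : ∀ {φ : C(ℕ → M, ℝ)} {c : ℝ},
      Tendsto (fun n => (T ^ n) φ) atTop (𝓝 (c • h)) → l φ = c := by
    intro φ c hc
    exact mul_right_cancel₀ (hh0 z).ne'
      (congrArg (fun w : C(ℕ → M, ℝ) => w z) (tendsto_nhds_unique (hl φ) hc))
  let L : C(ℕ → M, ℝ) →ₗ[ℝ] ℝ :=
    { toFun := l
      map_add' := fun φ ψ => huniq (by
        simpa only [map_add, add_smul] using (hl φ).add (hl ψ))
      map_smul' := fun c φ => huniq (by
        simpa only [map_smul, smul_assoc, RingHom.id_apply] using (hl φ).const_smul c) }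
  have hL1 : L 1 = 1 := huniq (by rwa [one_smul, hh])
  have hLnonneg : ∀ φ, 0 ≤ φ → 0 ≤ L φ := fun φ hφ =>
    nonneg_of_mul_nonneg_left (b := h z) (ge_of_tendsto' (heval (hl φ)) fun n =>
      smul_ruelle_pow_nonneg μ hlam n hφ z) (hh0 z)
  obtain ⟨ν, hν⟩ := exists_probabilityMeasure_integral_eq L hLnonneg hL1
  have hLT : ∀ φ, l (T φ) = l φ := fun φ => huniq (by
    refine ((tendsto_add_atTop_iff_nat 1).2 (hl φ)).congr fun n => ?_
    rw [pow_succ]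
    rfl)
  have hdual : ∀ ν' : ProbabilityMeasure (ℕ → M),
      ruelleDual μ f (toDual ν') = lam • toDual ν' ↔ ∀ φ, toDual ν' (T φ) = toDual ν' φ := by
    intro ν'
    rw [ContinuousLinearMap.ext_iff]
    refine forall_congr' fun φ => ?_
    change toDual ν' (ruelle μ f φ) = lam * toDual ν' φ ↔
      toDual ν' (lam⁻¹ • ruelle μ f φ) = toDual ν' φ
    rw [map_smul, smul_eq_mul, inv_mul_eq_iff_eq_mul₀ hlam.ne']
  refine ⟨lam, h, ν, hlam, hh0, heig, (hdual ν).2 fun φ => ?_, fun ν' hν' => ?_, fun φ => ?_⟩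
  · exact (hν (T φ)).trans ((hLT φ).trans (hν φ).symm)
  · rw [hdual] at hν'
    have hiter : ∀ (n : ℕ) φ, toDual ν' ((T ^ n) φ) = toDual ν' φ := by
      intro n
      induction n with
      | zero => exact fun φ => rfl
      | succ n ih =>
        intro φ
        rw [pow_succ]
        exact (ih (T φ)).trans (hν' φ)
    -- Integrating `T ^ n φ → l φ • h` against the `T`-invariant `ν'` determines it up to the factor
    -- `toDual ν' h`, which `φ = 1` shows to be `1`.
    have hval : ∀ φ, toDual ν' φ = l φ * toDual ν' h := by
      intro φ
      have h1 := ((toDual ν').continuous.tendsto _).comp (hl φ)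
      simp only [← hT, Function.comp_def, hiter, map_smul, smul_eq_mul] at h1
      exact tendsto_nhds_unique tendsto_const_nhds h1
    have h1 : toDual ν' 1 = 1 := by
      change ∫ x, (1 : ℝ) ∂(ν' : Measure (ℕ → M)) = 1
      simp
    have h2 : toDual ν' h = 1 := by
      have := hval 1
      rw [h1, show l 1 = 1 from hL1, one_mul] at this
      exact this.symm
    apply Subtype.ext
    have := ν'.2
    have := ν.2
    refine ext_of_forall_integral_eq_of_IsFiniteMeasure fun φ => ?_
    have h3 := hval φ.toContinuousMap
    rw [h2, mul_one] at h3
    exact h3.trans (hν φ.toContinuousMap).symm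
  · rw [← tendsto_iff_norm_sub_tendsto_zero, hν φ]
    exact (hl φ).congr fun n => smul_ruelle_pow_apply μ f lam n φ
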